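/- For integers $1\le s\le m$ and $n\ge 0$, let the $s$-sparse Johnson--Lindenstrauss matrix be the random matrix $$\Pi=\Big(\sqrt{\tfrac ms}\,\eta_1\odot \mathbf z_1,\ \dots,\ \sqrt{\tfrac ms}\,\eta_n\odot \mathbf z_n\Big)\in\mathbb R^{m\times n},$$ where $\odot$ is the entrywise product, each $\mathbf z_i$ is uniformly distributed on $\frac1{\sqrt m}\{1,-1\}^m$, each $\eta_i$ is uniformly distributed on the set of $s$-hot vectors of $\mathbb R^m$ (the $0/1$ vectors with exactly $s$ entries equal to $1$), and $\eta_1,\dots,\eta_n,\mathbf z_1,\dots,\mathbf z_n$ are mutually independent. There are absolute constants $C_1,C_2>0$ such that for all $0<\varepsilon,\delta<1/2$ the following holds. (i) If $s\le m$, $\;m\ge C_1\,\varepsilon^{-2}\log(1/\delta)$ and $s\ge C_2\,\varepsilon^{-1}\log(1/\delta)$, then for every $n$ and every fixed vector $x\in\mathbb R^n$, $$\mathbb P\Big(\|\Pi x\|_2^2\in\big[(1-\varepsilon)\|x\|_2^2,\ (1+\varepsilon)\|x\|_2^2\big]\Big)\ \ge\ 1-\delta .$$ (ii) There are integers $s\le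 m$ that satisfy the conditions of (i) and in addition $m\le 2C_1\,\varepsilon^{-2}\log(1/\delta)$ and $s\le 2C_2\,\varepsilon^{-1}\log(1/\delta)$. In particular, the $s$-sparse construction with suitable $m\simeq\varepsilon^{-2}\log(1/\delta)$ and $s\simeq\varepsilon^{-1}\log(1/\delta)$ satisfies the Johnson--Lindenstrauss guarantee. -/

import Mathlib

open MeasureTheory ProbabilityTheory

noncomputable section

/-- Real matrices carry the product (Borel) sigma-algebra of their entries. -/
instance matrixMeasurableSpace (m n : ℕ) : MeasurableSpace (Matrix (Fin m) (Fin n) ℝ) :=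
  inferInstanceAs (MeasurableSpace (Fin m → Fin n → ℝ))

/-- The `s`-hot vectors of `ℝ^m`: exactly `s` non-zero entries, each of them equal to `1`. -/
def hotVectors (m s : ℕ) : Set (Fin m → ℝ) :=
  {v | (∀ k, v k = 0 ∨ v k = 1) ∧ {k | v k ≠ 0}.ncard = s}

/-- The sign vectors `{1, -1}^m`. -/
def signVectors (m : ℕ) : Set (Fin m → ℝ) :=
  {v | ∀ k, v k = 1 ∨ v k = -1}

/-- The law `P_z = (1/√m) · U({1,-1}^m)`. -/
def signLaw (m : ℕ) : Measure (Fin m → ℝ) :=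
  (uniformOn (signVectors m)).map (fun v => (1 / Real.sqrt m) • v)

/-- The law of one column `√(m/s) · (η ⊙ z)` of the sparse JL matrix, where `η` is a uniformly
random `s`-hot vector and `z ∼ P_z` is independent of `η`. -/
def sparseJLColumnLaw (m s : ℕ) : Measure (Fin m → ℝ) :=
  ((uniformOn (hotVectors m s)).prod (signLaw m)).map
    (fun p => Real.sqrt ((m : ℝ) / s) • (p.1 * p.2))

/-- The law of the `s`-sparse JL matrix in `ℝ^{m × n}`: its `n` columns are independent, each with
the law `sparseJLColumnLaw m s`. -/
def sparseJLLaw (m n s : ℕ) : Measure (Matrix (Fin m) (Fin n) ℝ) :=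
  (Measure.pi (fun _ : Fin n => sparseJLColumnLaw m s)).map
    (fun c => Matrix.of (fun k i => c i k))

/-- `D` is a probability distribution on `ℝ^{m × n}` with the Johnson-Lindenstrauss guarantee:
for each fixed vector `x`, with probability at least `1 - δ` over `Π ∼ D`, the squared Euclidean
norm of `Π x` lies in `[(1 - ε)‖x‖², (1 + ε)‖x‖²]`. -/
def IsJLDistribution (ε δ : ℝ) {m n : ℕ} (D : Measure (Matrix (Fin m) (Fin n) ℝ)) : Prop :=
  IsProbabilityMeasure D ∧
    ∀ x : EuclideanSpace ℝ (Fin n),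
      1 - δ ≤ D.real {P : Matrix (Fin m) (Fin n) ℝ |
        ‖WithLp.toLp 2 (P.mulVec x.ofLp)‖ ^ 2 ∈
          Set.Icc ((1 - ε) * ‖x‖ ^ 2) ((1 + ε) * ‖x‖ ^ 2)}

end

/-! For a unit vector `x`, the mgf of `‖Πx‖² - 1` at `l` is at most `exp (4 l² / m)` when `|l| ≤ s /
10`; a Chernoff bound at `l = 3 ε⁻¹ log (1/δ)` then finishes.

Fix the supports. The rows are independent Rademacher sums, and `sum_exp_sq_rademacher_le` bounds
the exponential moment of each square by removing one sign at a time. What remains is `exp (t * ∑_{i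
≠ j} x_i² x_j² |h_i ∩ h_j|)` with `t = 2 (l / s)²`. The weights `x_i² x_j²` over all pairs sum to
`1`, so Jensen's inequality reduces the average over supports to one pair. There
`sum_exp_card_inter_le` gives `exp (2 t s² / m) = exp (4 l² / m)`, because containing a fixed set is
no likelier for a random `s`-subset than under independent sampling at rate `s / m`. -/

/-- The sign `±1` encoded by a Boolean. -/
def boolSign (b : Bool) : ℝ := if b then 1 else -1

/-! ### Exponential moments of squared Rademacher sums -/

/-- The cross term averages to a `cosh`, and `cosh u ≤ exp (u² / 2)`. The bound is again the
exponential of a quadratic in `c`, so it can be iterated over signs. -/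
lemma exp_sq_add_exp_sq_le (t c y : ℝ) :
    Real.exp (t * (c + y) ^ 2) + Real.exp (t * (c - y) ^ 2) ≤
      2 * Real.exp (t * y ^ 2 + (t + 2 * t ^ 2 * y ^ 2) * c ^ 2) := by
  have h := Real.cosh_le_exp_half_sq (2 * t * c * y)
  have h1 : Real.exp (t * (c + y) ^ 2) + Real.exp (t * (c - y) ^ 2) =
      2 * (Real.exp (t * c ^ 2 + t * y ^ 2) * Real.cosh (2 * t * c * y)) := by
    rw [Real.cosh_eq, show t * (c + y) ^ 2 = (t * c ^ 2 + t * y ^ 2) + 2 * t * c * y by ring,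
      show t * (c - y) ^ 2 = (t * c ^ 2 + t * y ^ 2) + -(2 * t * c * y) by ring,
      Real.exp_add, Real.exp_add _ (-(2 * t * c * y))]
    ring
  rw [h1, show t * y ^ 2 + (t + 2 * t ^ 2 * y ^ 2) * c ^ 2 =
    (t * c ^ 2 + t * y ^ 2) + (2 * t * c * y) ^ 2 / 2 by ring, Real.exp_add _ ((2 * t * c * y) ^ 2 / 2)]
  gcongr

/-- Exponential moments of the square of a shifted Rademacher sum. -/
lemma sum_exp_sq_rademacher_le (n : ℕ) (y : Fin n → ℝ) (μ c : ℝ)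
    (h : |μ| * ∑ i, y i ^ 2 ≤ 1 / 10) :
    ∑ τ : Fin n → Bool, Real.exp (μ * (c + ∑ i, boolSign (τ i) * y i) ^ 2) ≤
      2 ^ n * Real.exp ((μ + 4 * μ ^ 2 * ∑ i, y i ^ 2) * c ^ 2 + μ * ∑ i, y i ^ 2 +
        2 * μ ^ 2 * ((∑ i, y i ^ 2) ^ 2 - ∑ i, y i ^ 4)) := by
  induction n generalizing c with
  | zero => simp
  | succ n ih =>
    rw [← (Fin.consEquiv (fun _ : Fin (n + 1) => Bool)).sum_comp, Fintype.sum_prod_type]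
    simp only [Fin.consEquiv, Equiv.coe_fn_mk, Fin.sum_univ_succ, Fin.cons_zero, Fin.cons_succ,
      Fintype.sum_bool]
    rw [Fin.sum_univ_succ] at h
    set A := ∑ i : Fin n, y i.succ ^ 2 with hA
    set R := ∑ i : Fin n, y i.succ ^ 4 with hR
    have hA0 : 0 ≤ A := Finset.sum_nonneg fun i _ => sq_nonneg _
    have hA' : |μ| * A ≤ 1 / 10 := by
      nlinarith [mul_nonneg (abs_nonneg μ) (sq_nonneg (y 0))]
    have ih1 := ih (fun i => y i.succ) (c + y 0) hA'
    have ih2 := ih (fun i => y i.succ) (c - y 0) hA'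
    simp only [← hA, ← hR] at ih1 ih2
    simp only [boolSign, if_true, Bool.false_eq_true, if_false, one_mul, neg_mul, ← add_assoc] at *
    simp only [← sub_eq_add_neg]
    refine (add_le_add ih1 ih2).trans ?_
    have hstep := exp_sq_add_exp_sq_le (μ + 4 * μ ^ 2 * A) c (y 0)
    -- This is where `1 / 10` enters: `(1 + 4 / 10)² = 1.96 ≤ 2`, so each sign raises the
    -- coefficient of `c²` by at most `4 μ² y₀²`.
    have ht : 2 * (μ + 4 * μ ^ 2 * A) ^ 2 ≤ 4 * μ ^ 2 := by
      have h1 : |μ * A| ≤ 1 / 10 := by rwa [abs_mul, abs_of_nonneg hA0]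
      rw [abs_le] at h1
      have : (1 + 4 * (μ * A)) ^ 2 ≤ 2 := by nlinarith
      nlinarith [mul_le_mul_of_nonneg_left this (sq_nonneg μ)]
    calc _ = 2 ^ n * Real.exp (μ * A + 2 * μ ^ 2 * (A ^ 2 - R)) *
          (Real.exp ((μ + 4 * μ ^ 2 * A) * (c + y 0) ^ 2) +
            Real.exp ((μ + 4 * μ ^ 2 * A) * (c - y 0) ^ 2)) := by
          simp only [Real.exp_add]; ring
      _ ≤ 2 ^ n * Real.exp (μ * A + 2 * μ ^ 2 * (A ^ 2 - R)) *
          (2 * Real.exp ((μ + 4 * μ ^ 2 * A) * y 0 ^ 2 + ((μ + 4 * μ ^ 2 * A) +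
            2 * (μ + 4 * μ ^ 2 * A) ^ 2 * y 0 ^ 2) * c ^ 2)) := by gcongr
      _ = 2 ^ (n + 1) * Real.exp (μ * A + 2 * μ ^ 2 * (A ^ 2 - R) +
          ((μ + 4 * μ ^ 2 * A) * y 0 ^ 2 + ((μ + 4 * μ ^ 2 * A) +
            2 * (μ + 4 * μ ^ 2 * A) ^ 2 * y 0 ^ 2) * c ^ 2)) := by
          rw [Real.exp_add (μ * A + 2 * μ ^ 2 * (A ^ 2 - R))]; ring
      _ ≤ _ := by
          refine mul_le_mul_of_nonneg_left (Real.exp_le_exp.2 ?_) (by positivity)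
          nlinarith [mul_le_mul_of_nonneg_right ht (mul_nonneg (sq_nonneg (y 0)) (sq_nonneg c))]

/-- Independent rows of Rademacher sums. -/
lemma sum_exp_sum_sq_rademacher_le {m n : ℕ} (y : Fin m → Fin n → ℝ) (μ : ℝ)
    (h : ∀ r, |μ| * ∑ i, y r i ^ 2 ≤ 1 / 10) :
    ∑ σ : Fin n → Fin m → Bool,
        Real.exp (μ * ∑ r, ((∑ i, boolSign (σ i r) * y r i) ^ 2 - ∑ i, y r i ^ 2)) ≤
      (2 ^ m) ^ n * Real.exp (2 * μ ^ 2 * ∑ r, ((∑ i, y r i ^ 2) ^ 2 - ∑ i, y r i ^ 4)) := by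
  -- Indexing the signs by rows first makes the sum a product over rows.
  rw [← (Equiv.piComm (fun (_ : Fin m) (_ : Fin n) => Bool)).sum_comp]
  simp only [Equiv.piComm_apply, Function.swap, Finset.mul_sum, Real.exp_sum]
  rw [← Fintype.piFinset_univ, ← Finset.prod_univ_sum (fun _ => Finset.univ)
    (fun r (τ : Fin n → Bool) => Real.exp (μ * ((∑ i, boolSign (τ i) * y r i) ^ 2 - ∑ i, y r i ^ 2)))]
  have e : ((2 : ℝ) ^ m) ^ n = ∏ _r : Fin m, 2 ^ n := by simp [← pow_mul, mul_comm]
  rw [e, ← Finset.prod_mul_distrib]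
  refine Finset.prod_le_prod (fun r _ => by positivity) fun r _ => ?_
  have := sum_exp_sq_rademacher_le n (y r) μ 0 (h r)
  simp only [mul_sub μ, Real.exp_sub]
  rw [← Finset.sum_div, div_le_iff₀ (Real.exp_pos _)]
  simp only [zero_add] at this
  refine this.trans (le_of_eq ?_)
  rw [mul_assoc (2 ^ n), ← Real.exp_add]
  ring_nf

/-! ### Intersections of random `s`-subsets -/

lemma card_filter_subset_powersetCard {α : Type*} [Fintype α] [DecidableEq α] {s : ℕ}
    {c : Finset α} (hc : c.card ≤ s) :
    ((Finset.univ.powersetCard s).filter (c ⊆ ·)).card =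
      (Fintype.card α - c.card).choose (s - c.card) := by
  rw [← Finset.card_compl, ← Finset.card_powersetCard]
  refine Finset.card_nbij' (· \ c) (· ∪ c) ?_ ?_ ?_ ?_
  · intro b hb
    simp only [Finset.coe_filter, Finset.mem_powersetCard_univ, Set.mem_ofPred_eq] at hb
    simp only [Finset.mem_coe, Finset.mem_powersetCard]
    refine ⟨fun x hx => ?_, by rw [Finset.card_sdiff_of_subset hb.2, hb.1]⟩
    simpa using (Finset.mem_sdiff.1 hx).2
  · intro b hb
    simp only [Finset.mem_coe, Finset.mem_powersetCard] at hb
    simp only [Finset.coe_filter, Finset.mem_powersetCard_univ, Set.mem_ofPred_eq]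
    refine ⟨?_, Finset.subset_union_right⟩
    rw [Finset.card_union_of_disjoint, hb.2]
    · omega
    · exact Finset.subset_compl_iff_disjoint_right.1 hb.1
  · intro b hb
    simp only [Finset.coe_filter, Set.mem_ofPred_eq] at hb
    exact Finset.sdiff_union_of_subset hb.2
  · intro b hb
    simp only [Finset.mem_coe, Finset.mem_powersetCard] at hb
    exact Finset.union_sdiff_cancel_right (Finset.subset_compl_iff_disjoint_right.1 hb.1)

/-- The ratio of binomials is `∏_{i < k} (s - i) / (m - i)`, and each factor is at most `s / m`
since `s ≤ m`. -/
lemma choose_sub_mul_pow_le {m s k : ℕ} (hs : s ≤ m) (hk : k ≤ s) :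
    (m - k).choose (s - k) * m ^ k ≤ m.choose s * s ^ k := by
  induction k with
  | zero => simp
  | succ k ih =>
    have hstep : (m - (k + 1)).choose (s - (k + 1)) * m ≤ (m - k).choose (s - k) * s := by
      obtain ⟨a, rfl⟩ := Nat.exists_eq_add_of_le hk
      obtain ⟨b, rfl⟩ := Nat.exists_eq_add_of_le hs
      have h := Nat.add_one_mul_choose_eq (a + b) a
      rw [show k + 1 + a + b - (k + 1) = a + b by omega, show k + 1 + a - (k + 1) = a by omega,
        show k + 1 + a + b - k = a + b + 1 by omega, show k + 1 + a - k = a + 1 by omega]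
      refine le_of_mul_le_mul_left ?_ (show 0 < a + b + 1 by omega)
      calc (a + b + 1) * ((a + b).choose a * (k + 1 + a + b))
          = (a + b + 1).choose (a + 1) * ((a + 1) * (k + 1 + a + b)) := by
            rw [← mul_assoc, h]; ring
        _ ≤ (a + b + 1).choose (a + 1) * ((a + b + 1) * (k + 1 + a)) :=
            Nat.mul_le_mul_left _ (by nlinarith [Nat.zero_le (b * k)])
        _ = _ := by ring
    calc _ = (m - (k + 1)).choose (s - (k + 1)) * m * m ^ k := by ring
      _ ≤ (m - k).choose (s - k) * s * m ^ k := by gcongr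
      _ = (m - k).choose (s - k) * m ^ k * s := by ring
      _ ≤ m.choose s * s ^ k * s := Nat.mul_le_mul_right _ (ih (by omega))
      _ = _ := by ring

/-- In probabilistic terms, `P(c ⊆ b) ≤ (s / m) ^ |c|` for a uniform `s`-subset `b`. -/
lemma card_filter_subset_powersetCard_mul_le {m s : ℕ} (hs : s ≤ m) (c : Finset (Fin m)) :
    (((Finset.univ.powersetCard s).filter (c ⊆ ·)).card : ℝ) * (m : ℝ) ^ c.card ≤
      (m.choose s : ℝ) * (s : ℝ) ^ c.card := by
  by_cases hc : c.card ≤ s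
  · rw [card_filter_subset_powersetCard hc, Fintype.card_fin]
    exact_mod_cast choose_sub_mul_pow_le hs hc
  · rw [Finset.filter_false_of_mem, Finset.card_empty]
    · simp only [Nat.cast_zero, zero_mul]; positivity
    · intro b hb hcb
      rw [Finset.mem_powersetCard_univ] at hb
      exact hc (hb ▸ Finset.card_le_card hcb)

/-- The exponential moments of the intersection of a fixed `s`-subset with a random one. -/
lemma sum_exp_card_inter_le {m s : ℕ} (hs : s ≤ m) (hm : 0 < m) (a : Finset (Fin m)) (ha : a.card = s)
    {t : ℝ} (ht0 : 0 ≤ t) (ht1 : t ≤ 1) :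
    ∑ b ∈ Finset.univ.powersetCard s, Real.exp (t * ((a ∩ b).card : ℝ)) ≤
      (m.choose s : ℝ) * Real.exp (2 * t * ((s : ℝ) ^ 2 / m)) := by
  set θ := Real.exp t - 1 with hθ
  have hθ0 : 0 ≤ θ := by have := Real.add_one_le_exp t; linarith
  have hθ1 : θ ≤ 2 * t := by
    have := Real.abs_exp_sub_one_le (x := t) (by rwa [abs_of_nonneg ht0])
    rwa [abs_of_nonneg hθ0, abs_of_nonneg ht0] at this
  have hm' : (0 : ℝ) < m := by exact_mod_cast hm
  -- Expanding `(1 + θ) ^ |a ∩ b|` over subsets leaves only the events `c ⊆ b` to be averaged.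
  have key (b : Finset (Fin m)) : Real.exp (t * ((a ∩ b).card : ℝ)) =
      ∑ c ∈ a.powerset, if c ⊆ b then θ ^ c.card else 0 := by
    have h1 := Finset.sum_pow_mul_eq_add_pow θ 1 (a ∩ b)
    rw [mul_comm, Real.exp_nat_mul, show Real.exp t = θ + 1 by rw [hθ]; ring, ← h1,
      ← Finset.sum_filter]
    simp only [one_pow, mul_one]
    refine Finset.sum_congr ?_ fun _ _ => rfl
    ext c
    rw [Finset.mem_powerset, Finset.subset_inter_iff, Finset.mem_filter, Finset.mem_powerset]
  simp_rw [key]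
  rw [Finset.sum_comm]
  calc _ ≤ ∑ c ∈ a.powerset, (m.choose s : ℝ) * (θ * (s / m)) ^ c.card := by
        refine Finset.sum_le_sum fun c _ => ?_
        rw [← Finset.sum_filter, Finset.sum_const, nsmul_eq_mul, mul_pow, div_pow]
        have := card_filter_subset_powersetCard_mul_le hs c
        rw [← le_div_iff₀ (by positivity)] at this
        calc _ ≤ (m.choose s : ℝ) * (s : ℝ) ^ c.card / (m : ℝ) ^ c.card * θ ^ c.card := by gcongr
          _ = _ := by ring
    _ = (m.choose s : ℝ) * (θ * (s / m) + 1) ^ s := by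
        rw [← Finset.mul_sum, ← ha, ← Finset.sum_pow_mul_eq_add_pow]; simp
    _ ≤ (m.choose s : ℝ) * Real.exp (θ * (s / m)) ^ s := by
        gcongr; exact Real.add_one_le_exp _
    _ ≤ _ := by
        rw [← Real.exp_nat_mul]
        refine mul_le_mul_of_nonneg_left (Real.exp_le_exp.2 ?_) (by positivity)
        calc (s : ℝ) * (θ * (s / m)) = θ * ((s : ℝ) ^ 2 / m) := by ring
          _ ≤ _ := by gcongr

/-- The `s`-element subsets of `Fin m`: the supports of the `s`-hot vectors. -/
abbrev HotSet (m s : ℕ) : Type := ((Finset.univ : Finset (Fin m)).powersetCard s : Finset _)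

lemma HotSet.card_eq {m s : ℕ} (a : HotSet m s) : a.1.card = s :=
  Finset.mem_powersetCard_univ.1 a.2

lemma card_hotSet (m s : ℕ) : Fintype.card (HotSet m s) = m.choose s := by
  simp

/-- Freeze every coordinate except `j`: the bound on the remaining sum is uniform in the value at
`i`. -/
lemma sum_pi_le_of_forall_sum_le {ι α : Type*} [Fintype ι] [DecidableEq ι] [Fintype α]
    {i j : ι} (hij : i ≠ j) (g : α → α → ℝ) (K : ℝ)
    (hg : ∀ a, ∑ b, g a b ≤ Fintype.card α * K) :
    ∑ h : ι → α, g (h i) (h j) ≤ Fintype.card (ι → α) * K := by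
  rw [← (Equiv.funSplitAt j α).symm.sum_comp, Fintype.sum_prod_type_right,
    Fintype.card_congr (Equiv.funSplitAt j α), Fintype.card_prod]
  refine (Finset.sum_le_card_nsmul _ _ (Fintype.card α * K) fun r _ => ?_).trans (le_of_eq ?_)
  · simpa [Equiv.funSplitAt, Equiv.piSplitAt, hij] using hg (r ⟨i, hij⟩)
  · rw [nsmul_eq_mul, Finset.card_univ, Nat.cast_mul]; ring

lemma sum_pi_exp_card_inter_le {m n s : ℕ} (hs : s ≤ m) (hm : 0 < m) {t : ℝ} (ht0 : 0 ≤ t)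
    (ht1 : t ≤ 1) {i j : Fin n} (hij : i ≠ j) :
    ∑ h : Fin n → HotSet m s, Real.exp (t * (((h i).1 ∩ (h j).1).card : ℝ)) ≤
      Fintype.card (Fin n → HotSet m s) * Real.exp (2 * t * ((s : ℝ) ^ 2 / m)) := by
  refine sum_pi_le_of_forall_sum_le hij
    (fun a b : HotSet m s => Real.exp (t * ((a.1 ∩ b.1).card : ℝ))) _ fun a => ?_
  rw [card_hotSet, Finset.sum_coe_sort _ (fun b => Real.exp (t * ((a.1 ∩ b).card : ℝ)))]
  exact sum_exp_card_inter_le hs hm a.1 a.card_eq ht0 ht1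

/-! ### Moment generating function of the squared norm -/

/-- The squared norm of the image of `x`, for given supports `h` and signs `σ`. -/
noncomputable def sparseNormSq {m n : ℕ} (s : ℕ) (x : Fin n → ℝ) (h : Fin n → HotSet m s)
    (σ : Fin n → Fin m → Bool) : ℝ :=
  (s : ℝ)⁻¹ * ∑ r, (∑ i, boolSign (σ i r) * (if r ∈ (h i).1 then x i else 0)) ^ 2

/-- Every column has exactly `s` nonzero entries, so the row energies total `s` whatever the
supports. The diagonal part of `‖Πx‖²` is thus exactly `1`, and only off-diagonal overlaps
contribute. -/
lemma sum_exp_sparseNormSq_signs_le {m n s : ℕ} (hs0 : 0 < s) (x : Fin n → ℝ)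
    (hx : ∑ i, x i ^ 2 = 1) (h : Fin n → HotSet m s) {l : ℝ} (hl : |l| ≤ s / 10) :
    ∑ σ : Fin n → Fin m → Bool, Real.exp (l * (sparseNormSq s x h σ - 1)) ≤
      (2 ^ m) ^ n * Real.exp (2 * (l / s) ^ 2 * ∑ i, ∑ j, x i ^ 2 * x j ^ 2 *
        (if i = j then 0 else (((h i).1 ∩ (h j).1).card : ℝ))) := by
  have hs' : (0 : ℝ) < s := by exact_mod_cast hs0
  set y : Fin m → Fin n → ℝ := fun r i => if r ∈ (h i).1 then x i else 0 with hy
  have hrow (r : Fin m) : ∑ i, y r i ^ 2 ≤ 1 := by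
    rw [← hx]
    refine Finset.sum_le_sum fun i _ => ?_
    simp only [hy]; split_ifs
    · exact le_rfl
    · simpa using sq_nonneg (x i)
  have hmu : |l / s| ≤ 1 / 10 := by
    rw [abs_div, abs_of_pos hs', div_le_iff₀ hs']; linarith
  have key := sum_exp_sum_sq_rademacher_le y (l / s) fun r =>
    (mul_le_of_le_one_right (abs_nonneg _) (hrow r)).trans hmu
  have htot : ∑ r, ∑ i, y r i ^ 2 = s := by
    rw [Finset.sum_comm]
    calc _ = ∑ i, (s : ℝ) * x i ^ 2 := by
          refine Finset.sum_congr rfl fun i _ => ?_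
          simp [hy, ite_pow, (h i).card_eq]
      _ = s := by rw [← Finset.mul_sum, hx, mul_one]
  have hexp (σ : Fin n → Fin m → Bool) : l * (sparseNormSq s x h σ - 1) =
      l / s * ∑ r, ((∑ i, boolSign (σ i r) * y r i) ^ 2 - ∑ i, y r i ^ 2) := by
    rw [Finset.sum_sub_distrib, htot, sparseNormSq]
    simp only [hy]
    field_simp
  have hfrob : ∑ r, ((∑ i, y r i ^ 2) ^ 2 - ∑ i, y r i ^ 4) = ∑ i, ∑ j, x i ^ 2 * x j ^ 2 *
        (if i = j then 0 else (((h i).1 ∩ (h j).1).card : ℝ)) := by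
    have hr (r : Fin m) : (∑ i, y r i ^ 2) ^ 2 - ∑ i, y r i ^ 4 =
        ∑ i, ∑ j, if i = j then 0 else y r i ^ 2 * y r j ^ 2 := by
      rw [sq (∑ i, y r i ^ 2), Finset.sum_mul_sum, ← Finset.sum_sub_distrib]
      refine Finset.sum_congr rfl fun i _ => ?_
      rw [← Finset.sum_erase_add _ _ (Finset.mem_univ i),
        ← Finset.sum_erase_add _ _ (Finset.mem_univ i), if_pos rfl, add_zero,
        show y r i ^ 2 * y r i ^ 2 = y r i ^ 4 by ring, add_sub_cancel_right]
      exact Finset.sum_congr rfl fun j hj => (if_neg (Finset.ne_of_mem_erase hj).symm).symm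
    simp_rw [hr]
    rw [Finset.sum_comm]
    refine Finset.sum_congr rfl fun i _ => ?_
    rw [Finset.sum_comm]
    refine Finset.sum_congr rfl fun j _ => ?_
    split_ifs
    · simp
    · rw [show (((h i).1 ∩ (h j).1).card : ℝ) =
        ∑ r, if r ∈ (h i).1 ∩ (h j).1 then 1 else 0 by
          rw [Finset.sum_boole, Finset.filter_univ_mem], Finset.mul_sum]
      refine Finset.sum_congr rfl fun r _ => ?_
      by_cases h1 : r ∈ (h i).1 <;> by_cases h2 : r ∈ (h j).1 <;> simp [hy, h1, h2]
  simp_rw [hexp]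
  rwa [hfrob] at key

/-- The exponential moments of `‖Π x‖² - 1` for a unit vector `x`. -/
lemma sum_exp_sparseNormSq_le {m n s : ℕ} (hs : s ≤ m) (hs0 : 0 < s) (x : Fin n → ℝ)
    (hx : ∑ i, x i ^ 2 = 1) {l : ℝ} (hl : |l| ≤ s / 10) :
    ∑ h : Fin n → HotSet m s, ∑ σ : Fin n → Fin m → Bool,
        Real.exp (l * (sparseNormSq s x h σ - 1)) ≤
      Fintype.card (Fin n → HotSet m s) * (2 ^ m) ^ n * Real.exp (4 * l ^ 2 / m) := by
  have hs' : (0 : ℝ) < s := by exact_mod_cast hs0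
  have hm : 0 < m := hs0.trans_le hs
  have hm' : (0 : ℝ) < m := by exact_mod_cast hm
  set t := 2 * (l / s) ^ 2 with ht
  have ht0 : 0 ≤ t := by positivity
  have ht1 : t ≤ 1 := by
    have h1 : |l / s| ≤ 1 / 10 := by
      rw [abs_div, abs_of_pos hs', div_le_iff₀ hs']; linarith
    have h2 := abs_le.1 h1
    nlinarith
  have hts : 2 * t * ((s : ℝ) ^ 2 / m) = 4 * l ^ 2 / m := by
    rw [ht]; field_simp; ring
  set Q : (Fin n → HotSet m s) → Fin n → Fin n → ℝ := fun h i j =>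
    if i = j then 0 else (((h i).1 ∩ (h j).1).card : ℝ) with hQ
  have hw : ∑ p : Fin n × Fin n, x p.1 ^ 2 * x p.2 ^ 2 = 1 := by
    rw [Fintype.sum_prod_type, ← Finset.sum_mul_sum (f := fun i => x i ^ 2) (g := fun i => x i ^ 2),
      hx, one_mul]
  -- Jensen's inequality spares any analysis of the joint law of the overlaps: one pair at a time
  -- suffices.
  have hjensen (h : Fin n → HotSet m s) :
      Real.exp (t * ∑ i, ∑ j, x i ^ 2 * x j ^ 2 * Q h i j) ≤
        ∑ p : Fin n × Fin n, x p.1 ^ 2 * x p.2 ^ 2 * Real.exp (t * Q h p.1 p.2) := by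
    have := convexOn_exp.map_sum_le (t := Finset.univ)
      (w := fun p : Fin n × Fin n => x p.1 ^ 2 * x p.2 ^ 2) (p := fun p => t * Q h p.1 p.2)
      (fun p _ => by positivity) hw (fun _ _ => Set.mem_univ _)
    simp only [smul_eq_mul] at this
    refine le_trans (le_of_eq ?_) this
    rw [Fintype.sum_prod_type, Finset.mul_sum]
    congr 1
    refine Finset.sum_congr rfl fun i _ => ?_
    rw [Finset.mul_sum]
    exact Finset.sum_congr rfl fun j _ => by ring
  have hpair (p : Fin n × Fin n) : ∑ h : Fin n → HotSet m s, Real.exp (t * Q h p.1 p.2) ≤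
      Fintype.card (Fin n → HotSet m s) * Real.exp (4 * l ^ 2 / m) := by
    by_cases hp : p.1 = p.2
    · simp only [hQ, hp, if_true, mul_zero, Real.exp_zero, Finset.sum_const, Finset.card_univ,
        nsmul_eq_mul]
      exact mul_le_mul_of_nonneg_left (Real.one_le_exp (by positivity)) (Nat.cast_nonneg _)
    · simp only [hQ, if_neg hp]
      rw [← hts]
      exact sum_pi_exp_card_inter_le hs hm ht0 ht1 hp
  calc _ ≤ ∑ h : Fin n → HotSet m s, (2 ^ m) ^ n *
        ∑ p : Fin n × Fin n, x p.1 ^ 2 * x p.2 ^ 2 * Real.exp (t * Q h p.1 p.2) := by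
        refine Finset.sum_le_sum fun h _ => ?_
        exact (sum_exp_sparseNormSq_signs_le hs0 x hx h hl).trans
          (mul_le_mul_of_nonneg_left (hjensen h) (by positivity))
    _ = (2 ^ m) ^ n * ∑ p : Fin n × Fin n, x p.1 ^ 2 * x p.2 ^ 2 *
          ∑ h : Fin n → HotSet m s, Real.exp (t * Q h p.1 p.2) := by
        rw [← Finset.mul_sum, Finset.sum_comm]
        simp_rw [Finset.mul_sum]
    _ ≤ (2 ^ m) ^ n * ∑ p : Fin n × Fin n, x p.1 ^ 2 * x p.2 ^ 2 *
          (Fintype.card (Fin n → HotSet m s) * Real.exp (4 * l ^ 2 / m)) := by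
        gcongr with p
        exact hpair p
    _ = _ := by rw [← Finset.sum_mul, hw]; ring

/-! ### The matrix law as the image of a finite uniform seed -/

lemma uniformOn_range_eq_map {α β : Type*} [Fintype α] [MeasurableSpace α]
    [DiscreteMeasurableSpace α] [MeasurableSpace β] [MeasurableSingletonClass β] {e : α → β}
    (he : Function.Injective e) :
    uniformOn (Set.range e) = (uniformOn Set.univ).map e := by
  ext t ht
  have hcount (u : Set α) : Measure.count (e '' u) = Measure.count u :=
    Measure.count_injective_image he u
  rw [Measure.map_apply Measurable.of_discrete ht, uniformOn_univ, uniformOn,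
    cond_apply (Set.finite_range e).measurableSet, ← Set.image_univ, ← Set.image_inter_preimage,
    hcount, hcount, Set.univ_inter, Measure.count_univ, ENat.card_eq_coe_fintype_card,
    ENNReal.div_eq_inv_mul]
  rfl

/-- The uniform law on pairs of an `s`-subset and a Boolean vector. -/
noncomputable def columnSeed (m s : ℕ) : Measure (HotSet m s × (Fin m → Bool)) :=
  (uniformOn Set.univ).prod (uniformOn Set.univ)

/-- The indicator vector of an `s`-subset. -/
def hotVector {m s : ℕ} (a : HotSet m s) (k : Fin m) : ℝ := if k ∈ a.1 then 1 else 0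

lemma hotVector_injective {m s : ℕ} : Function.Injective (hotVector (m := m) (s := s)) := by
  intro a b h
  ext k
  have := congrFun h k
  by_cases h1 : k ∈ a.1 <;> by_cases h2 : k ∈ b.1 <;> simp_all [hotVector]

lemma range_hotVector (m s : ℕ) : Set.range (hotVector (m := m) (s := s)) = hotVectors m s := by
  classical
  ext v
  constructor
  · rintro ⟨a, rfl⟩
    refine ⟨fun k => by unfold hotVector; split_ifs <;> simp, ?_⟩
    have : {k | hotVector a k ≠ 0} = (a.1 : Set (Fin m)) := by
      ext k; simp [hotVector]
    rw [this, Set.ncard_coe_finset, a.card_eq]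
  · rintro ⟨h01, hcard⟩
    refine ⟨⟨Finset.univ.filter (v · ≠ 0), ?_⟩, ?_⟩
    · rw [Finset.mem_powersetCard_univ, ← hcard, ← Set.ncard_coe_finset]
      simp
    · ext k
      rcases h01 k with h | h <;> simp [hotVector, h]

lemma boolSign_comp_injective (m : ℕ) :
    Function.Injective (fun (b : Fin m → Bool) k => boolSign (b k)) := by
  intro a b h
  ext k
  have := congrFun h k
  cases h1 : a k <;> cases h2 : b k <;> simp [boolSign, h1, h2] at this ⊢ <;> norm_num at this

lemma range_boolSign_comp (m : ℕ) :
    Set.range (fun (b : Fin m → Bool) k => boolSign (b k)) = signVectors m := by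
  classical
  ext v
  constructor
  · rintro ⟨b, rfl⟩ k
    cases h : b k <;> simp [boolSign, h]
  · intro h
    refine ⟨fun k => decide (v k = 1), ?_⟩
    ext k
    rcases h k with h | h <;> simp [boolSign, h]
    norm_num

/-- The column of the sparse JL matrix given by a support and a sign pattern. -/
noncomputable def sparseColumn {m s : ℕ} (p : HotSet m s × (Fin m → Bool)) : Fin m → ℝ :=
  Real.sqrt ((m : ℝ) / s) • (hotVector p.1 * ((1 / Real.sqrt m) • fun k => boolSign (p.2 k)))

lemma sparseColumn_apply {m s : ℕ} (hm : 0 < m) (p : HotSet m s × (Fin m → Bool)) (k : Fin m) :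
    sparseColumn p k = (Real.sqrt s)⁻¹ * (boolSign (p.2 k) * if k ∈ p.1.1 then 1 else 0) := by
  have : Real.sqrt m ≠ 0 := by positivity
  simp only [sparseColumn, Pi.smul_apply, Pi.mul_apply, smul_eq_mul, hotVector,
    Real.sqrt_div (Nat.cast_nonneg m)]
  field_simp

lemma isProbabilityMeasure_columnSeed {m s : ℕ} (hs : s ≤ m) :
    IsProbabilityMeasure (columnSeed m s) := by
  have : Nonempty (HotSet m s) := by
    rw [← Fintype.card_pos_iff, card_hotSet]
    exact Nat.choose_pos hs
  have h1 : IsProbabilityMeasure (uniformOn (Set.univ : Set (HotSet m s))) :=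
    isProbabilityMeasure_uniformOn Set.finite_univ Set.univ_nonempty
  have h2 : IsProbabilityMeasure (uniformOn (Set.univ : Set (Fin m → Bool))) :=
    isProbabilityMeasure_uniformOn Set.finite_univ Set.univ_nonempty
  unfold columnSeed
  infer_instance

lemma columnSeed_singleton {m s : ℕ} (p : HotSet m s × (Fin m → Bool)) :
    columnSeed m s {p} = ((m.choose s : ENNReal) * 2 ^ m)⁻¹ := by
  rw [columnSeed, ← Prod.mk.eta (p := p), ← Set.singleton_prod_singleton, Measure.prod_prod,
    uniformOn_univ, uniformOn_univ, Measure.count_singleton, Measure.count_singleton, card_hotSet,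
    ENNReal.mul_inv (by simp) (by simp)]
  simp

lemma sparseJLColumnLaw_eq_map (m s : ℕ) :
    sparseJLColumnLaw m s = (columnSeed m s).map sparseColumn := by
  have hsmul : Measurable (fun v : Fin m → ℝ => (1 / Real.sqrt m) • v) := by fun_prop
  have hmul : Measurable (fun p : (Fin m → ℝ) × (Fin m → ℝ) =>
      Real.sqrt ((m : ℝ) / s) • (p.1 * p.2)) := by fun_prop
  rw [sparseJLColumnLaw, signLaw, ← range_hotVector, ← range_boolSign_comp,
    uniformOn_range_eq_map hotVector_injective, uniformOn_range_eq_map (boolSign_comp_injective m),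
    Measure.map_map hsmul Measurable.of_discrete,
    Measure.map_prod_map _ _ Measurable.of_discrete Measurable.of_discrete,
    Measure.map_map hmul Measurable.of_discrete]
  rfl

lemma sparseJLLaw_eq_map {m s : ℕ} (n : ℕ) (hs : s ≤ m) :
    sparseJLLaw m n s = (Measure.pi fun _ : Fin n => columnSeed m s).map
      (fun ω => Matrix.of fun k i => sparseColumn (ω i) k) := by
  have := isProbabilityMeasure_columnSeed hs
  have hcol : IsProbabilityMeasure ((columnSeed m s).map sparseColumn) :=
    Measure.isProbabilityMeasure_map Measurable.of_discrete.aemeasurable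
  have hof : Measurable (fun c : Fin n → Fin m → ℝ => Matrix.of fun k i => c i k) := by
    refine measurable_pi_iff.2 fun k => measurable_pi_iff.2 fun i => ?_
    exact (measurable_pi_apply k).comp (measurable_pi_apply i)
  rw [sparseJLLaw, sparseJLColumnLaw_eq_map,
    ← Measure.pi_map_pi fun _ => Measurable.of_discrete.aemeasurable,
    Measure.map_map hof Measurable.of_discrete]
  rfl

lemma norm_mulVec_sparseColumn_sq {m n s : ℕ} (hm : 0 < m)
    (ω : Fin n → HotSet m s × (Fin m → Bool)) (x : Fin n → ℝ) :
    ‖WithLp.toLp 2 ((Matrix.of fun k i => sparseColumn (ω i) k).mulVec x)‖ ^ 2 =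
      sparseNormSq s x (fun i => (ω i).1) (fun i => (ω i).2) := by
  rw [EuclideanSpace.norm_sq_eq, sparseNormSq, Finset.mul_sum]
  refine Finset.sum_congr rfl fun k _ => ?_
  have : (s : ℝ)⁻¹ = (Real.sqrt s)⁻¹ ^ 2 := by rw [inv_pow, Real.sq_sqrt (Nat.cast_nonneg s)]
  rw [this, ← mul_pow, Real.norm_eq_abs, sq_abs, Finset.mul_sum]
  refine congrArg (· ^ 2) ?_
  simp only [Matrix.mulVec, dotProduct]
  refine Finset.sum_congr rfl fun i _ => ?_
  rw [Matrix.of_apply, sparseColumn_apply hm]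
  split_ifs <;> ring

lemma sparseNormSq_smul {m n s : ℕ} (x : Fin n → ℝ) (c : ℝ) (h : Fin n → HotSet m s)
    (σ : Fin n → Fin m → Bool) :
    sparseNormSq s (c • x) h σ = c ^ 2 * sparseNormSq s x h σ := by
  simp only [sparseNormSq, Pi.smul_apply, smul_eq_mul]
  rw [mul_left_comm, Finset.mul_sum _ _ (c ^ 2)]
  congr 1
  refine Finset.sum_congr rfl fun r _ => ?_
  rw [← mul_pow, Finset.mul_sum]
  congr 1
  refine Finset.sum_congr rfl fun i _ => ?_
  split_ifs <;> ring

/-! ### Tail bound and choice of constants -/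

lemma mgf_sparseNormSq_le {m n s : ℕ} (hs : s ≤ m) (hs0 : 0 < s) (x : Fin n → ℝ)
    (hx : ∑ i, x i ^ 2 = 1) {l : ℝ} (hl : |l| ≤ s / 10) :
    mgf (fun ω => sparseNormSq s x (fun i => (ω i).1) (fun i => (ω i).2) - 1)
      (Measure.pi fun _ : Fin n => columnSeed m s) l ≤ Real.exp (4 * l ^ 2 / m) := by
  have := isProbabilityMeasure_columnSeed hs
  have hpos : (0 : ℝ) < m.choose s := by exact_mod_cast Nat.choose_pos hs
  have key := sum_exp_sparseNormSq_le hs hs0 x hx hl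
  rw [mgf, integral_fintype Integrable.of_finite]
  have hw (ω : Fin n → HotSet m s × (Fin m → Bool)) :
      (Measure.pi fun _ : Fin n => columnSeed m s).real {ω} =
        (((m.choose s : ℝ) * 2 ^ m) ^ n)⁻¹ := by
    simp only [Measure.real, Measure.pi_singleton, columnSeed_singleton, Finset.prod_const,
      Finset.card_univ, Fintype.card_fin]
    simp [mul_comm, mul_pow]
  simp only [hw, smul_eq_mul]
  rw [← Finset.mul_sum, inv_mul_le_iff₀ (by positivity),
    ← (Equiv.arrowProdEquivProdArrow (Fin n) (fun _ => HotSet m s)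
      (fun _ => Fin m → Bool)).symm.sum_comp, Fintype.sum_prod_type]
  rw [Fintype.card_fun, card_hotSet, Fintype.card_fin, Nat.cast_pow, ← mul_pow] at key
  exact key

lemma measureReal_abs_sparseNormSq_sub_one_le {m n s : ℕ} (hs : s ≤ m) (hs0 : 0 < s)
    (x : Fin n → ℝ) (hx : ∑ i, x i ^ 2 = 1) {l ε : ℝ} (hl0 : 0 ≤ l) (hl : l ≤ s / 10) :
    (Measure.pi fun _ : Fin n => columnSeed m s).real
      {ω | ε ≤ |sparseNormSq s x (fun i => (ω i).1) (fun i => (ω i).2) - 1|} ≤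
        2 * Real.exp (4 * l ^ 2 / m - l * ε) := by
  have := isProbabilityMeasure_columnSeed hs
  set X : (Fin n → HotSet m s × (Fin m → Bool)) → ℝ := fun ω =>
    sparseNormSq s x (fun i => (ω i).1) (fun i => (ω i).2) - 1
  have hsub : {ω | ε ≤ |X ω|} ⊆ {ω | ε ≤ X ω} ∪ {ω | X ω ≤ -ε} := by
    intro ω hω
    rcases le_abs.1 (show ε ≤ |X ω| from hω) with h | h
    · exact Or.inl h
    · exact Or.inr (show X ω ≤ -ε by linarith)
  have hup := measure_ge_le_exp_mul_mgf (μ := Measure.pi fun _ : Fin n => columnSeed m s)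
    (X := X) ε hl0 Integrable.of_finite
  have hlow := measure_le_le_exp_mul_mgf (μ := Measure.pi fun _ : Fin n => columnSeed m s)
    (X := X) (-ε) (neg_nonpos.2 hl0) Integrable.of_finite
  have h1 := mgf_sparseNormSq_le hs hs0 x hx (l := l) (by rwa [abs_of_nonneg hl0])
  have h2 := mgf_sparseNormSq_le hs hs0 x hx (l := -l) (by rwa [abs_neg, abs_of_nonneg hl0])
  refine (measureReal_mono hsub).trans ((measureReal_union_le _ _).trans ?_)
  calc _ ≤ Real.exp (-l * ε) * Real.exp (4 * l ^ 2 / m) +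
        Real.exp (-(-l) * -ε) * Real.exp (4 * (-l) ^ 2 / m) :=
        add_le_add (hup.trans (by gcongr)) (hlow.trans (by gcongr))
    _ = _ := by
        rw [← Real.exp_add, ← Real.exp_add, two_mul]
        ring_nf

lemma isJLDistribution_sparseJLLaw {m s : ℕ} (n : ℕ) (hs : s ≤ m) (hs0 : 0 < s) {ε δ l : ℝ}
    (hδ : 0 ≤ δ) (hl0 : 0 ≤ l) (hl : l ≤ s / 10) (h : 2 * Real.exp (4 * l ^ 2 / m - l * ε) ≤ δ) :
    IsJLDistribution ε δ (sparseJLLaw m n s) := by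
  have := isProbabilityMeasure_columnSeed hs
  have hm : 0 < m := hs0.trans_le hs
  rw [sparseJLLaw_eq_map n hs]
  refine ⟨Measure.isProbabilityMeasure_map Measurable.of_discrete.aemeasurable, fun x => ?_⟩
  have hmeas : MeasurableSet {P : Matrix (Fin m) (Fin n) ℝ |
      ‖WithLp.toLp 2 (P.mulVec x.ofLp)‖ ^ 2 ∈
        Set.Icc ((1 - ε) * ‖x‖ ^ 2) ((1 + ε) * ‖x‖ ^ 2)} := by
    refine measurableSet_Icc.preimage (f := fun P : Matrix (Fin m) (Fin n) ℝ =>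
      ‖WithLp.toLp 2 (P.mulVec x.ofLp)‖ ^ 2) ?_
    simp only [EuclideanSpace.norm_sq_eq, Matrix.mulVec, dotProduct]
    have hentry (k : Fin m) (i : Fin n) : Measurable fun P : Matrix (Fin m) (Fin n) ℝ => P k i :=
      (measurable_pi_apply i).comp (measurable_pi_apply (X := fun _ => Fin n → ℝ) k)
    fun_prop
  rw [map_measureReal_apply Measurable.of_discrete hmeas]
  simp only [Set.preimage_ofPred_eq, norm_mulVec_sparseColumn_sq hm]
  -- For `x = 0` the interval is `{0}`; otherwise homogeneity reduces to a unit vector.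
  rcases eq_or_ne x 0 with rfl | hx
  · have h0 (ω : Fin n → HotSet m s × (Fin m → Bool)) : sparseNormSq s
        (0 : Fin n → ℝ) (fun i => (ω i).1) (fun i => (ω i).2) = 0 := by
      simp [sparseNormSq]
    simp [h0, hδ]
  · have hx' : 0 < ‖x‖ := norm_pos_iff.2 hx
    set y : Fin n → ℝ := ‖x‖⁻¹ • x.ofLp with hy
    have hxy : x.ofLp = ‖x‖ • y := by rw [hy, smul_smul, mul_inv_cancel₀ hx'.ne', one_smul]
    have hy1 : ∑ i, y i ^ 2 = 1 := by
      simp only [hy, Pi.smul_apply, smul_eq_mul, mul_pow]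
      rw [← Finset.mul_sum, ← EuclideanSpace.real_norm_sq_eq, ← mul_pow,
        inv_mul_cancel₀ hx'.ne', one_pow]
    have htail := (measureReal_abs_sparseNormSq_sub_one_le hs hs0 y hy1 (ε := ε) hl0 hl).trans h
    refine (sub_le_sub_left htail 1).trans ?_
    rw [← probReal_compl_eq_one_sub (MeasurableSet.of_discrete)]
    refine measureReal_mono fun ω hω => ?_
    simp only [Set.mem_compl_iff, Set.mem_ofPred_eq, not_le, abs_lt] at hω
    simp only [Set.mem_ofPred_eq, hxy, sparseNormSq_smul]
    have hx2 : 0 < ‖x‖ ^ 2 := by positivity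
    constructor <;> nlinarith

theorem mainTheorem4 :
    ∃ C₁ C₂ : ℝ, 0 < C₁ ∧ 0 < C₂ ∧
      ∀ ε δ : ℝ, 0 < ε → ε < 1 / 2 → 0 < δ → δ < 1 / 2 →
        (∀ m s : ℕ, s ≤ m →
          C₁ * ((ε ^ 2)⁻¹ * Real.log (1 / δ)) ≤ (m : ℝ) →
          C₂ * (ε⁻¹ * Real.log (1 / δ)) ≤ (s : ℝ) →
          ∀ n : ℕ, IsJLDistribution ε δ (sparseJLLaw m n s)) ∧
        (∃ m s : ℕ, s ≤ m ∧
          C₁ * ((ε ^ 2)⁻¹ * Real.log (1 / δ)) ≤ (m : ℝ) ∧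
          (m : ℝ) ≤ 2 * (C₁ * ((ε ^ 2)⁻¹ * Real.log (1 / δ))) ∧
          C₂ * (ε⁻¹ * Real.log (1 / δ)) ≤ (s : ℝ) ∧
          (s : ℝ) ≤ 2 * (C₂ * (ε⁻¹ * Real.log (1 / δ)))) := by
  -- With `L = log (1/δ)` and `l = 3 L / ε`, the constant `30` ensures `l ≤ s / 10` and `36` ensures
  -- `4 l² / m ≤ L`. The exponent is then at most `L - 3 L = -2 L`, and `2 δ² ≤ δ`.
  refine ⟨36, 30, by norm_num, by norm_num, fun ε δ hε hε2 hδ hδ2 => ?_⟩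
  have hlog : 1 / 2 < Real.log (1 / δ) := by
    refine lt_of_lt_of_le (by linarith [Real.log_two_gt_d9]) (Real.log_le_log two_pos ?_)
    rw [le_div_iff₀ hδ]; linarith
  have hexp : Real.exp (-Real.log (1 / δ)) = δ := by
    rw [one_div, Real.log_inv, neg_neg, Real.exp_log hδ]
  set L := Real.log (1 / δ)
  have hεinv : 1 ≤ ε⁻¹ := (one_le_inv₀ hε).2 (by linarith)
  have hεinv2 : ε⁻¹ ≤ (ε ^ 2)⁻¹ := by
    rw [← inv_pow]; nlinarith
  -- Both thresholds are at least `1`, so rounding up at most doubles them.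
  have hB : 1 ≤ 30 * (ε⁻¹ * L) := by nlinarith
  have hBA : 30 * (ε⁻¹ * L) ≤ 36 * ((ε ^ 2)⁻¹ * L) := by
    have := mul_le_mul_of_nonneg_right hεinv2 (show 0 ≤ L by linarith)
    nlinarith
  refine ⟨fun m s hs hm hs' n => ?_, ⌈36 * ((ε ^ 2)⁻¹ * L)⌉₊, ⌈30 * (ε⁻¹ * L)⌉₊,
    Nat.ceil_mono hBA, Nat.le_ceil _, ?_, Nat.le_ceil _, ?_⟩
  · have hs0 : 0 < s := by
      have : (0 : ℝ) < s := by linarith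
      exact_mod_cast this
    have hm0 : (0 : ℝ) < m := by linarith
    refine isJLDistribution_sparseJLLaw n hs hs0 (l := 3 * (ε⁻¹ * L)) hδ.le (by linarith)
      (by linarith) ?_
    have h1 : 4 * (3 * (ε⁻¹ * L)) ^ 2 / m ≤ L := by
      rw [div_le_iff₀ hm0]
      calc _ = 36 * ((ε ^ 2)⁻¹ * L) * L := by rw [← inv_pow]; ring
        _ ≤ m * L := mul_le_mul_of_nonneg_right hm (by linarith)
        _ = _ := mul_comm _ _
    have h2 : 3 * (ε⁻¹ * L) * ε = 3 * L := by field_simp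
    calc _ ≤ 2 * Real.exp (-L + -L) := by
          refine mul_le_mul_of_nonneg_left (Real.exp_le_exp.2 ?_) two_pos.le
          linarith
      _ = 2 * (δ * δ) := by rw [Real.exp_add, hexp]
      _ ≤ δ := by nlinarith
  · have := Nat.ceil_lt_add_one (show 0 ≤ 36 * ((ε ^ 2)⁻¹ * L) by linarith)
    linarith
  · have := Nat.ceil_lt_add_one (show 0 ≤ 30 * (ε⁻¹ * L) by linarith)
    linarith
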